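/- Let $(\Omega,\mu)$ be a $\sigma$-finite measure space with $\mu$ non-atomic. Functions on $\Omega$ are real- or complex-valued measurable functions, identified if they agree $\mu$-almost everywhere, and $f^*(t)=\inf\{s\ge 0:\mu\{|f|>s\}\le t\}$, $t>0$, is the non-increasing rearrangement of $f$. Write $\|\cdot\|_{q,(0,\infty)}$ for the (quasi-)norm of the Lebesgue space $L_q(0,\infty)$, $0<q\le\infty$, and put $1/\infty=0$, $1/0=\infty$. A positive Lebesgue measurable function $b$ on $(0,\infty)$ is called slowly varying, $b\in SV$, if for every $\varepsilon>0$ the function $t^{\varepsilon}b(t)$ is equivalent to a non-decreasing function and $t^{-\varepsilon}b(t)$ is equivalent to a non-increasing function on $(0,\infty)$ (two functions being equivalent if each is at most a constant times the other). For $0<p,q\le\infty$ and $a\in SV$ the Lorentz–Karamata space $L_{p,q;a}$ is the set of all measurable $f$ on $\Omega$ with $$\|f\|_{p,q;a}=\big\|t^{\frac1p-\frac1q}a(t)f^*(t)\big\|_{q,(0,\infty)}<\infty ;$$ in particular $L_{p,\infty}=L_{p,\infty;1}$ is the weak Lebesgue space. $L_p$ $(0<p\le\infty)$ is the Lebesgue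 space $L_p(\Omega,\mu)$. For a couple $(A_0,A_1)$ of such spaces and $f\in A_0+A_1$ let $$K(t,f;A_0,A_1)=\inf\{\|f_0\|_{A_0}+t\|f_1\|_{A_1}: f=f_0+f_1,\ f_i\in A_i,\ i=0,1\},\qquad t>0,$$ and, for $0\le\theta\le1$, $0<q\le\infty$ and $a\in SV$, let $(A_0,A_1)_{\theta,q;a}$ be the set of all $f\in A_0+A_1$ with $$\|f\|_{\theta,q;a}=\big\|t^{-\theta-\frac1q}a(t)K(t,f;A_0,A_1)\big\|_{q,(0,\infty)}<\infty .$$ **Theorem.** Let $0<\theta\le1$, $0<\varkappa<\infty$, $p=\frac{\varkappa}{1-\theta}$ (so $p=\infty$ if $\theta=1$), $0<q\le\infty$ and $b\in SV$, and let $\tilde b(t)=b(t^{1/\varkappa})$, $t>0$. Then $$(L_\varkappa,L_\infty)_{\theta,q;b}=(L_{\varkappa,\infty},L_\infty)_{\theta,q;b}=L_{p,q;\tilde b}.$$ Here equality of two spaces means that they consist of the same functions and that their quasi-norms are equivalent, that is, each is at most a constant, not depending on the function, times the other. -/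

import Mathlib

open MeasureTheory Set
open scoped ENNReal NNReal

noncomputable section

namespace LorentzKaramata

/-- A measure is non-atomic if every measurable set of positive measure contains a measurable
subset of strictly smaller positive measure. -/
def NonAtomic {Ω : Type*} [MeasurableSpace Ω] (μ : Measure Ω) : Prop :=
  ∀ A : Set Ω, MeasurableSet A → 0 < μ A →
    ∃ B : Set Ω, B ⊆ A ∧ MeasurableSet B ∧ 0 < μ B ∧ μ B < μ A

/-- `f ≈ g` on `(0, ∞)`: each of the two functions is bounded by a constant times the other. -/
def EquivOnPos (f g : ℝ → ℝ) : Prop :=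
  ∃ C : ℝ, 0 < C ∧ ∀ t : ℝ, 0 < t → f t ≤ C * g t ∧ g t ≤ C * f t

/-- Slowly varying functions on `(0, ∞)`; values of `b` outside `(0, ∞)` are irrelevant. -/
structure SlowlyVarying (b : ℝ → ℝ) : Prop where
  aemeasurable : AEMeasurable b (volume.restrict (Ioi 0))
  pos : ∀ t : ℝ, 0 < t → 0 < b t
  increasing : ∀ ε : ℝ, 0 < ε →
    ∃ g : ℝ → ℝ, MonotoneOn g (Ioi 0) ∧ EquivOnPos (fun t => t ^ ε * b t) g
  decreasing : ∀ ε : ℝ, 0 < ε →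
    ∃ g : ℝ → ℝ, AntitoneOn g (Ioi 0) ∧ EquivOnPos (fun t => t ^ (-ε) * b t) g

/-- `‖ t ^ (r - 1/q) * a t * φ t ‖` in `L_q(0, ∞)`, with `1/∞ = 0`. -/
def weightedNorm (r : ℝ) (q : ℝ≥0∞) (a : ℝ → ℝ) (φ : ℝ → ℝ≥0∞) : ℝ≥0∞ :=
  eLpNorm (fun t : ℝ => ENNReal.ofReal (t ^ (r - (q⁻¹).toReal) * a t) * φ t) q
    (volume.restrict (Ioi 0))

/-- A subset of `X` together with its (quasi-)norm, recorded as a functional on all of `X`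
whose values outside the subset are irrelevant. -/
structure Space (X : Type*) where
  carrier : Set X
  qnorm : X → ℝ≥0∞

namespace Space

variable {X : Type*}

/-- The space of all elements at which a given extended-valued functional is finite. -/
def ofNorm (N : X → ℝ≥0∞) : Space X where
  carrier := {f | N f < ∞}
  qnorm := N

/-- Continuous embedding `A ⊂ B`. -/
def Embeds (A B : Space X) : Prop :=
  A.carrier ⊆ B.carrier ∧ ∃ C : ℝ≥0, ∀ f ∈ A.carrier, B.qnorm f ≤ C * A.qnorm f

/-- Equality of spaces: continuous embeddings in both directions, that is, the same elements
and equivalent quasi-norms. -/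
def Same (A B : Space X) : Prop :=
  A.Embeds B ∧ B.Embeds A

/-- The Peetre `K`-functional of a couple. -/
def K [Add X] (A₀ A₁ : Space X) (t : ℝ) (f : X) : ℝ≥0∞ :=
  ⨅ (f₀ ∈ A₀.carrier) (f₁ ∈ A₁.carrier) (_ : f = f₀ + f₁),
    A₀.qnorm f₀ + ENNReal.ofReal t * A₁.qnorm f₁

/-- The quasi-norm of `(A₀, A₁)_{θ,q;a}`. -/
def interpNorm [Add X] (A₀ A₁ : Space X) (θ : ℝ) (q : ℝ≥0∞) (a : ℝ → ℝ) (f : X) : ℝ≥0∞ :=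
  weightedNorm (-θ) q a (fun t => K A₀ A₁ t f)

/-- The real interpolation space `(A₀, A₁)_{θ,q;a}`: all `f ∈ A₀ + A₁` with
`‖ t ^ (-θ - 1/q) * a t * K(t, f) ‖_{q,(0,∞)} < ∞`. -/
def interp [Add X] (A₀ A₁ : Space X) (θ : ℝ) (q : ℝ≥0∞) (a : ℝ → ℝ) : Space X where
  carrier := {f | (∃ f₀ ∈ A₀.carrier, ∃ f₁ ∈ A₁.carrier, f = f₀ + f₁) ∧
    interpNorm A₀ A₁ θ q a f < ∞}
  qnorm := interpNorm A₀ A₁ θ q a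

end Space

/-- The non-increasing rearrangement `f*(t) = inf {s ≥ 0 : μ {|f| > s} ≤ t}`, `t > 0`. -/
def rearrangement {Ω 𝕜 : Type*} [RCLike 𝕜] [MeasurableSpace Ω] {μ : Measure Ω}
    (f : Ω →ₘ[μ] 𝕜) (t : ℝ) : ℝ≥0∞ :=
  sInf {s : ℝ≥0∞ | μ {x | s < ‖f x‖ₑ} ≤ ENNReal.ofReal t}

/-- The Lebesgue space `L_r(Ω, μ)`, `0 < r ≤ ∞`. -/
def lebesgueSpace (𝕜 : Type*) [RCLike 𝕜] {Ω : Type*} [MeasurableSpace Ω] (μ : Measure Ω)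
    (r : ℝ≥0∞) : Space (Ω →ₘ[μ] 𝕜) :=
  Space.ofNorm fun f => eLpNorm f r μ

/-- The Lorentz–Karamata space `L_{p,q;a}(Ω, μ)`: all measurable `f` with
`‖ t ^ (1/p - 1/q) * a t * f*(t) ‖_{q,(0,∞)} < ∞`, where `1/∞ = 0`. -/
def lorentzKaramata (𝕜 : Type*) [RCLike 𝕜] {Ω : Type*} [MeasurableSpace Ω] (μ : Measure Ω)
    (p q : ℝ≥0∞) (a : ℝ → ℝ) : Space (Ω →ₘ[μ] 𝕜) :=
  Space.ofNorm fun f => weightedNorm (p⁻¹).toReal q a (rearrangement f)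

/-- The Lorentz space `L_{p,q}(Ω, μ)`; for `q = ∞` this is the weak Lebesgue space. -/
def lorentzSpace (𝕜 : Type*) [RCLike 𝕜] {Ω : Type*} [MeasurableSpace Ω] (μ : Measure Ω)
    (p q : ℝ≥0∞) : Space (Ω →ₘ[μ] 𝕜) :=
  lorentzKaramata 𝕜 μ p q fun _ => 1

end LorentzKaramata

end

/-! The three spaces are tied together by a cycle of embeddings: `(L_κ, L_∞)_{θ,q;b} ⊂ (L_{κ,∞},
L_∞)_{θ,q;b} ⊂ L_{p,q;b̃} ⊂ (L_κ, L_∞)_{θ,q;b}`.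

The first follows from Chebyshev's inequality, `L_κ ⊂ L_{κ,∞}`. The second follows from `t f*(t^κ) ≤
2 K(t, f; L_{κ,∞}, L_∞)` (`mul_rearrangement_rpow_le_K`), a consequence of `(f₀ + f₁)* ≤ f₀* +
‖f₁‖_∞`, and the substitution `t ↦ t^κ`.

The third carries the weight. Cutting `f` at height `f*(t^κ)` and slicing the upper part dyadically
gives, for each `γ > 1/2`, `K(t, f; L_κ, L_∞) ≤ C sup_j γ^j t f*((2^(-j-1) t)^κ)`
(`K_lebesgueSpace_le_iSup`). For `γ = 2^(θ/4-1)`, slow variation bounds the weighted `j`-th term by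
a constant times `ρ^j` times a dilate of `t^(1-θ) b(t) f*(t^κ)`, with `ρ = 2^(-θ/2) < 1`. As `dt/t`
is dilation invariant, a geometric series finishes (`haarNorm_iSup_dilation_le`). A supremum instead
of a sum treats all `q` alike, without a triangle inequality. -/

noncomputable section

namespace LorentzKaramata

/-! ### Norms with respect to `dt/t`: substitutions and dilations -/

/-- The norm of `L_q((0, ∞), dt/t)`. -/
def haarNorm (q : ℝ≥0∞) (H : ℝ → ℝ≥0∞) : ℝ≥0∞ :=
  eLpNorm (fun t : ℝ => ENNReal.ofReal (t ^ (-(q⁻¹).toReal)) * H t) q (volume.restrict (Ioi 0))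

theorem weightedNorm_eq_haarNorm (r : ℝ) (q : ℝ≥0∞) (a : ℝ → ℝ) (φ : ℝ → ℝ≥0∞) :
    weightedNorm r q a φ = haarNorm q fun t => ENNReal.ofReal (t ^ r * a t) * φ t := by
  refine eLpNorm_congr_ae ?_
  filter_upwards [ae_restrict_mem measurableSet_Ioi] with t ht
  have ht : 0 < t := ht
  rw [← mul_assoc, ← ENNReal.ofReal_mul (by positivity), ← mul_assoc, ← Real.rpow_add ht]
  ring_nf

theorem haarNorm_mono {q : ℝ≥0∞} {G H : ℝ → ℝ≥0∞} {C : ℝ≥0}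
    (h : ∀ t, 0 < t → G t ≤ C * H t) : haarNorm q G ≤ C * haarNorm q H := by
  refine eLpNorm_le_mul_eLpNorm_of_ae_le_mul' ?_ q
  filter_upwards [ae_restrict_mem measurableSet_Ioi] with t ht
  simp only [enorm_eq_self]
  calc _ ≤ ENNReal.ofReal (t ^ (-(q⁻¹).toReal)) * (C * H t) := by gcongr; exact h t ht
    _ = _ := by ring

theorem haarNorm_congr {q : ℝ≥0∞} {G H : ℝ → ℝ≥0∞} (h : ∀ t, 0 < t → G t = H t) :
    haarNorm q G = haarNorm q H := by
  refine eLpNorm_congr_ae ?_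
  filter_upwards [ae_restrict_mem measurableSet_Ioi] with t ht
  rw [h t ht]

theorem haarNorm_top (H : ℝ → ℝ≥0∞) :
    haarNorm ∞ H = essSup H (volume.restrict (Ioi 0)) := by
  simp [haarNorm, eLpNormEssSup]

theorem haarNorm_of_ne_top {q : ℝ≥0∞} (hq : q ≠ 0) (hq' : q ≠ ∞) (H : ℝ → ℝ≥0∞) :
    haarNorm q H =
      (∫⁻ t in Ioi (0 : ℝ), ENNReal.ofReal t⁻¹ * H t ^ q.toReal) ^ (1 / q.toReal) := by
  have hpos := ENNReal.toReal_pos hq hq'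
  rw [haarNorm, eLpNorm_eq_lintegral_rpow_enorm_toReal hq hq']
  congr 1
  refine setLIntegral_congr_fun measurableSet_Ioi fun t ht => ?_
  have ht : 0 < t := ht
  simp only [enorm_eq_self]
  rw [ENNReal.mul_rpow_of_nonneg _ _ hpos.le, ENNReal.ofReal_rpow_of_nonneg (by positivity) hpos.le,
    ← Real.rpow_mul ht.le, ENNReal.toReal_inv, neg_mul, inv_mul_cancel₀ hpos.ne',
    Real.rpow_neg_one]

theorem image_mul_rpow_Ioi {c k : ℝ} (hc : 0 < c) (hk : 0 < k) :
    (fun t : ℝ => c * t ^ k) '' Ioi 0 = Ioi 0 := by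
  ext u
  constructor
  · rintro ⟨t, ht, rfl⟩
    have ht : 0 < t := ht
    exact (by positivity : 0 < c * t ^ k)
  · intro hu
    have hu : 0 < u := hu
    refine ⟨(u / c) ^ k⁻¹, (by positivity : 0 < (u / c) ^ k⁻¹), ?_⟩
    simp only
    rw [Real.rpow_inv_rpow (by positivity) hk.ne']
    field_simp

theorem lintegral_inv_comp_mul_rpow {c k : ℝ} (hc : 0 < c) (hk : 0 < k) (H : ℝ → ℝ≥0∞) :
    ∫⁻ u in Ioi (0 : ℝ), ENNReal.ofReal u⁻¹ * H u =
      ENNReal.ofReal k * ∫⁻ t in Ioi (0 : ℝ), ENNReal.ofReal t⁻¹ * H (c * t ^ k) := by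
  have h := lintegral_image_eq_lintegral_abs_deriv_mul (s := Ioi (0 : ℝ))
    (f := fun t => c * t ^ k) (f' := fun t => c * (k * t ^ (k - 1))) measurableSet_Ioi
    (fun t ht => ((Real.hasDerivAt_rpow_const (Or.inl (ne_of_gt ht))).const_mul c).hasDerivWithinAt)
    (fun x hx y hy hxy => (Real.rpow_left_inj (le_of_lt hx) (le_of_lt hy) hk.ne').1
      (mul_left_cancel₀ hc.ne' hxy)) (fun u => ENNReal.ofReal u⁻¹ * H u)
  rw [image_mul_rpow_Ioi hc hk] at h
  rw [h, ← lintegral_const_mul' _ _ ENNReal.ofReal_ne_top]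
  refine setLIntegral_congr_fun measurableSet_Ioi fun t ht => ?_
  have ht : 0 < t := ht
  have e : |c * (k * t ^ (k - 1))| * (c * t ^ k)⁻¹ = k * t⁻¹ := by
    rw [abs_of_pos (by positivity), Real.rpow_sub_one ht.ne']
    field_simp
  rw [← mul_assoc, ← ENNReal.ofReal_mul (by positivity), e, ENNReal.ofReal_mul hk.le, mul_assoc]

theorem quasiMeasurePreserving_mul_rpow {c k : ℝ} (hc : 0 < c) (hk : 0 < k) :
    Measure.QuasiMeasurePreserving (fun t : ℝ => c * t ^ k)
      (volume.restrict (Ioi 0)) (volume.restrict (Ioi 0)) := by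
  refine ⟨by fun_prop, Measure.AbsolutelyContinuous.mk fun s hs h0 => ?_⟩
  rw [Measure.map_apply (by fun_prop) hs]
  -- The substitution formula applied to the indicator of a null set shows that its preimage is
  -- null.
  have h := lintegral_inv_comp_mul_rpow hc hk (s.indicator 1)
  have h0' : ∫⁻ u in Ioi (0 : ℝ), ENNReal.ofReal u⁻¹ * s.indicator 1 u = 0 := by
    rw [lintegral_eq_zero_iff' (by fun_prop (disch := assumption))]
    filter_upwards [measure_eq_zero_iff_ae_notMem.1 h0] with u hu
    simp [hu]
  rw [h0', eq_comm, mul_eq_zero, or_iff_right (by simpa using hk), lintegral_eq_zero_iff'] at h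
  · rw [measure_eq_zero_iff_ae_notMem]
    filter_upwards [h, ae_restrict_mem measurableSet_Ioi] with t ht ht0 hmem
    have ht0 : 0 < t := ht0
    simp only [Pi.zero_apply, mul_eq_zero, ENNReal.ofReal_eq_zero, inv_nonpos,
      not_le.2 ht0, false_or] at ht
    rw [indicator_of_mem (show c * t ^ k ∈ s from hmem)] at ht
    simp at ht
  · have : Measurable (s.indicator (1 : ℝ → ℝ≥0∞)) := measurable_one.indicator hs
    fun_prop

theorem haarNorm_comp_mul_rpow_le {c k : ℝ} (hc : 0 < c) (hk : 0 < k) {q : ℝ≥0∞} (hq : q ≠ 0)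
    (H : ℝ → ℝ≥0∞) :
    haarNorm q (fun t => H (c * t ^ k)) ≤ (k⁻¹ ^ (q⁻¹).toReal).toNNReal * haarNorm q H := by
  rcases eq_or_ne q ∞ with rfl | hq'
  · simp only [haarNorm_top, ENNReal.inv_top, ENNReal.toReal_zero, Real.rpow_zero,
      Real.toNNReal_one, ENNReal.coe_one, one_mul]
    exact essSup_le_of_ae_le _ ((quasiMeasurePreserving_mul_rpow hc hk).ae
      (ENNReal.ae_le_essSup H))
  · rw [haarNorm_of_ne_top hq hq', haarNorm_of_ne_top hq hq',
      lintegral_inv_comp_mul_rpow hc hk (fun u => H u ^ q.toReal),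
      ENNReal.mul_rpow_of_nonneg _ _ (by positivity), ← mul_assoc]
    refine le_of_eq ?_
    rw [← ENNReal.ofReal, ENNReal.ofReal_rpow_of_nonneg hk.le (by positivity),
      ← ENNReal.ofReal_mul (by positivity), Real.inv_rpow hk.le, ENNReal.toReal_inv, one_div,
      inv_mul_cancel₀ (by positivity), ENNReal.ofReal_one, one_mul]

/-- For `q < ∞` the `q`-th power of a supremum is at most the sum of the `q`-th powers, and
dilations preserve `dt/t`; what remains is a geometric series with ratio `ρ^q`. For `q = ∞` each
term is already dominated. -/
theorem haarNorm_iSup_dilation_le {q : ℝ≥0∞} (hq : q ≠ 0) {ρ : ℝ} (hρ : ρ < 1)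
    {c : ℕ → ℝ} (hc : ∀ j, 0 < c j) :
    ∃ C : ℝ≥0, ∀ H : ℝ → ℝ≥0∞, AEMeasurable H (volume.restrict (Ioi 0)) →
      haarNorm q (fun t => ⨆ j : ℕ, ENNReal.ofReal ρ ^ j * H (c j * t)) ≤ C * haarNorm q H := by
  have hqmp (j : ℕ) := by simpa using quasiMeasurePreserving_mul_rpow (hc j) one_pos
  rcases eq_or_ne q ∞ with rfl | hq'
  · refine ⟨1, fun H _ => ?_⟩
    simp only [haarNorm_top, ENNReal.coe_one, one_mul]
    refine essSup_le_of_ae_le _ ?_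
    filter_upwards [ae_all_iff.2 fun j => (hqmp j).ae (ENNReal.ae_le_essSup H)] with t ht
    refine iSup_le fun j => (mul_le_mul' (pow_le_one' ?_ j) (ht j)).trans_eq (one_mul _)
    simpa using hρ.le
  · have hpos := ENNReal.toReal_pos hq hq'
    set s := q.toReal
    set r : ℝ≥0∞ := ENNReal.ofReal ρ ^ s
    have hr : r < 1 := ENNReal.rpow_lt_one (by simpa using hρ) hpos
    have hsum : (∑' j : ℕ, r ^ j) ≠ ∞ := by
      rw [ENNReal.tsum_geometric]
      simpa [tsub_eq_zero_iff_le] using hr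
    refine ⟨((∑' j : ℕ, r ^ j) ^ (1 / s)).toNNReal, fun H hH => ?_⟩
    rw [ENNReal.coe_toNNReal (ENNReal.rpow_ne_top_of_nonneg (by positivity) hsum),
      haarNorm_of_ne_top hq hq', haarNorm_of_ne_top hq hq',
      ← ENNReal.mul_rpow_of_nonneg _ _ (by positivity)]
    refine ENNReal.rpow_le_rpow ?_ (by positivity)
    calc ∫⁻ t in Ioi (0 : ℝ), ENNReal.ofReal t⁻¹ * (⨆ j, ENNReal.ofReal ρ ^ j * H (c j * t)) ^ s
        ≤ ∫⁻ t in Ioi (0 : ℝ), ∑' j : ℕ, r ^ j * (ENNReal.ofReal t⁻¹ * H (c j * t) ^ s) := by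
          refine lintegral_mono fun t => ?_
          rw [(ENNReal.monotone_rpow_of_nonneg hpos.le).map_iSup_of_continuousAt
            (ENNReal.continuous_rpow_const.continuousAt) (by simpa using hpos), ENNReal.mul_iSup]
          refine iSup_le fun j => le_trans (le_of_eq ?_) (ENNReal.le_tsum j)
          rw [ENNReal.mul_rpow_of_nonneg _ _ hpos.le, ← ENNReal.rpow_natCast,
            ← ENNReal.rpow_natCast, ← ENNReal.rpow_mul, ← ENNReal.rpow_mul, mul_comm s]
          ring
      _ = ∑' j : ℕ, r ^ j * ∫⁻ t in Ioi (0 : ℝ), ENNReal.ofReal t⁻¹ * H t ^ s := by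
          rw [lintegral_tsum]
          · refine tsum_congr fun j => ?_
            rw [lintegral_const_mul' _ _ (ENNReal.pow_ne_top hr.ne_top),
              lintegral_inv_comp_mul_rpow (hc j) one_pos (fun t => H t ^ s)]
            simp
          · intro j
            have : AEMeasurable (fun t => H (c j * t)) (volume.restrict (Ioi 0)) :=
              hH.comp_quasiMeasurePreserving (hqmp j)
            fun_prop
      _ = _ := by rw [ENNReal.tsum_mul_right]

/-- A Potter-type bound. The factor `C * C` arises from passing to the monotone equivalent of
`t^(-ε) b(t)` and back. -/
theorem SlowlyVarying.mul_le {b : ℝ → ℝ} (hb : SlowlyVarying b) {ε : ℝ} (hε : 0 < ε) :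
    ∃ C : ℝ, 0 < C ∧ ∀ l t : ℝ, 1 ≤ l → 0 < t → b (l * t) ≤ C * l ^ ε * b t := by
  obtain ⟨g, hg, C, hC, h⟩ := hb.decreasing ε hε
  refine ⟨C * C, by positivity, fun l t hl ht => ?_⟩
  have hl0 : 0 < l := by linarith
  have hlt : 0 < l * t := by positivity
  have h1 : (l * t) ^ (-ε) * b (l * t) ≤ C * (C * (t ^ (-ε) * b t)) :=
    (h _ hlt).1.trans (mul_le_mul_of_nonneg_left
      ((hg ht hlt (by nlinarith)).trans (h t ht).2) hC.le)
  rw [Real.mul_rpow hl0.le ht.le] at h1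
  have h2 := mul_le_mul_of_nonneg_left h1 (by positivity : 0 ≤ l ^ ε * t ^ ε)
  have e1 : l ^ ε * l ^ (-ε) = 1 := by rw [← Real.rpow_add hl0]; simp
  have e2 : t ^ ε * t ^ (-ε) = 1 := by rw [← Real.rpow_add ht]; simp
  calc b (l * t) = (l ^ ε * l ^ (-ε)) * (t ^ ε * t ^ (-ε)) * b (l * t) := by rw [e1, e2]; ring
    _ ≤ l ^ ε * t ^ ε * (C * (C * (t ^ (-ε) * b t))) := by linarith
    _ = C * C * l ^ ε * (t ^ ε * t ^ (-ε)) * b t := by ring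
    _ = _ := by rw [e2]; ring

/-! ### The non-increasing rearrangement -/

section Rearrangement

variable {Ω 𝕜 : Type*} [RCLike 𝕜] [MeasurableSpace Ω] {μ : Measure Ω}

theorem rearrangement_antitone (f : Ω →ₘ[μ] 𝕜) : Antitone (rearrangement f) :=
  fun _ _ h => sInf_le_sInf fun _ hs => le_trans hs (ENNReal.ofReal_le_ofReal h)

/-- The infimum defining `f*(t)` is attained: along levels decreasing to it the superlevel sets
increase, and `μ` is continuous from below. -/
theorem measure_rearrangement_lt_le (f : Ω →ₘ[μ] 𝕜) (t : ℝ) :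
    μ {x | rearrangement f t < ‖f x‖ₑ} ≤ ENNReal.ofReal t := by
  obtain ⟨u, hu, hlim, hmem⟩ := exists_seq_tendsto_sInf
    (S := {s : ℝ≥0∞ | μ {x | s < ‖f x‖ₑ} ≤ ENNReal.ofReal t}) ⟨∞, by simp⟩ (OrderBot.bddBelow _)
  have hsub : {x | rearrangement f t < ‖f x‖ₑ} ⊆ ⋃ n, {x | u n < ‖f x‖ₑ} := fun x hx =>
    mem_iUnion.2 ((hlim.eventually_lt_const hx).exists)
  refine (measure_mono hsub).trans ?_
  have hmono : Monotone fun n => {x | u n < ‖f x‖ₑ} :=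
    fun m n hmn x hx => lt_of_le_of_lt (hu hmn) hx
  rw [hmono.measure_iUnion]
  exact iSup_le hmem

theorem rearrangement_add_le (f g : Ω →ₘ[μ] 𝕜) (t : ℝ) :
    rearrangement (f + g) t ≤ rearrangement f t + eLpNorm g ∞ μ := by
  refine sInf_le (le_trans (measure_mono_ae ?_) (measure_rearrangement_lt_le f t))
  filter_upwards [AEEqFun.coeFn_add f g, ae_le_eLpNormEssSup (f := g) (μ := μ)] with x hx hg hlt
  have hlt : rearrangement f t + eLpNorm g ∞ μ < ‖(f + g) x‖ₑ := hlt
  rw [eLpNorm_exponent_top, hx] at hlt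
  by_contra hle
  have hle : ‖f x‖ₑ ≤ rearrangement f t := not_lt.1 hle
  exact absurd (hlt.trans_le (enorm_add_le _ _)) (not_lt.2 (add_le_add hle hg))

/-- Chebyshev's inequality at each level `s' < f*(t)`, where `μ {|f| > s'} > t`. -/
theorem rpow_mul_rearrangement_le {k : ℝ} (hk : 0 < k) (f : Ω →ₘ[μ] 𝕜) {t : ℝ} (ht : 0 < t) :
    ENNReal.ofReal (t ^ (1 / k)) * rearrangement f t ≤ eLpNorm f (ENNReal.ofReal k) μ := by
  have h0 : ENNReal.ofReal (t ^ (1 / k)) ≠ 0 := by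
    simpa using (by positivity : 0 < t ^ k⁻¹)
  rw [mul_comm, ← ENNReal.le_div_iff_mul_le (Or.inl h0) (Or.inl ENNReal.ofReal_ne_top)]
  refine le_of_forall_lt fun s hs => ?_
  obtain ⟨s', hss', hs'⟩ := exists_between hs
  refine hss'.trans_le ?_
  rw [ENNReal.le_div_iff_mul_le (Or.inl h0) (Or.inl ENNReal.ofReal_ne_top),
    ← ENNReal.rpow_le_rpow_iff hk, ENNReal.mul_rpow_of_nonneg _ _ hk.le,
    ENNReal.ofReal_rpow_of_nonneg (by positivity) hk.le, ← Real.rpow_mul ht.le,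
    one_div_mul_cancel hk.ne', Real.rpow_one]
  have hlt : ENNReal.ofReal t < μ {x | s' < ‖f x‖ₑ} := 
    not_le.1 fun hle => hs'.not_ge (sInf_le hle)
  have h := mul_meas_ge_le_pow_eLpNorm' μ (p := ENNReal.ofReal k) (by simpa using hk)
    ENNReal.ofReal_ne_top f.aestronglyMeasurable s'
  rw [ENNReal.toReal_ofReal hk.le] at h
  have hsub : {x | s' < ‖f x‖ₑ} ⊆ {x | s' ≤ ‖f x‖ₑ} := fun x hx => LT.lt.le (a := s') hx
  exact le_trans (mul_le_mul_right (hlt.le.trans (measure_mono hsub)) _) h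

end Rearrangement

/-! ### Abstract couples and the `K`-functional -/

namespace Space

theorem le_mul_K {X : Type*} [Add X] {A₀ A₁ : Space X} {t : ℝ} {f : X} {x : ℝ≥0∞} {C : ℝ≥0}
    (hC : C ≠ 0) (h : ∀ f₀ ∈ A₀.carrier, ∀ f₁ ∈ A₁.carrier, f = f₀ + f₁ →
      x ≤ C * (A₀.qnorm f₀ + ENNReal.ofReal t * A₁.qnorm f₁)) : x ≤ C * K A₀ A₁ t f := by
  rw [mul_comm, ← ENNReal.div_le_iff_le_mul (Or.inl (by simpa using hC)) (Or.inl ENNReal.coe_ne_top)]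
  refine le_iInf₂ fun f₀ h₀ => le_iInf₂ fun f₁ h₁ => le_iInf fun hf => ?_
  rw [ENNReal.div_le_iff_le_mul (Or.inl (by simpa using hC)) (Or.inl ENNReal.coe_ne_top), mul_comm]
  exact h f₀ h₀ f₁ h₁ hf

theorem K_le {X : Type*} [Add X] {A₀ A₁ : Space X} {f₀ f₁ : X} (h₀ : f₀ ∈ A₀.carrier)
    (h₁ : f₁ ∈ A₁.carrier) (t : ℝ) :
    K A₀ A₁ t (f₀ + f₁) ≤ A₀.qnorm f₀ + ENNReal.ofReal t * A₁.qnorm f₁ :=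
  iInf₂_le_of_le f₀ h₀ <| iInf₂_le_of_le f₁ h₁ <| iInf_le_of_le rfl le_rfl

theorem exists_decomposition_of_K_lt_top {X : Type*} [Add X] {A₀ A₁ : Space X} {t : ℝ} {f : X}
    (h : K A₀ A₁ t f < ∞) : ∃ f₀ ∈ A₀.carrier, ∃ f₁ ∈ A₁.carrier, f = f₀ + f₁ := by
  simp only [K, iInf_lt_iff] at h
  obtain ⟨f₀, h₀, f₁, h₁, hf, -⟩ := h
  exact ⟨f₀, h₀, f₁, h₁, hf⟩

theorem Embeds.trans {X : Type*} {A B C : Space X} (h₁ : A.Embeds B) (h₂ : B.Embeds C) :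
    A.Embeds C := by
  obtain ⟨s₁, c₁, h₁⟩ := h₁
  obtain ⟨s₂, c₂, h₂⟩ := h₂
  refine ⟨s₁.trans s₂, c₂ * c₁, fun f hf => (h₂ f (s₁ hf)).trans ?_⟩
  rw [ENNReal.coe_mul, mul_assoc]
  gcongr
  exact h₁ f hf

theorem Embeds.interp_left {X : Type*} [Add X] {A B : Space X} (h : A.Embeds B) (D : Space X)
    (θ : ℝ) (q : ℝ≥0∞) (a : ℝ → ℝ) : (interp A D θ q a).Embeds (interp B D θ q a) := by
  obtain ⟨hs, c, h⟩ := h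
  -- The constant must dominate both `c` and the coefficient `1` of the unchanged second norm.
  have hK (t : ℝ) (f : X) : K B D t f ≤ (max c 1 : ℝ≥0) * K A D t f := by
    refine le_mul_K (by positivity) ?_
    rintro f₀ h₀ f₁ h₁ rfl
    refine (K_le (hs h₀) h₁ t).trans ?_
    rw [mul_add]
    refine add_le_add ?_ ?_
    · exact (h f₀ h₀).trans (by gcongr; exact le_max_left _ _)
    · exact le_mul_of_one_le_left' (by exact_mod_cast le_max_right c 1)
  have hN (f : X) : interpNorm B D θ q a f ≤ (max c 1 : ℝ≥0) * interpNorm A D θ q a f := by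
    simp only [interpNorm, weightedNorm_eq_haarNorm]
    refine haarNorm_mono fun t _ => ?_
    rw [mul_left_comm]
    gcongr
    exact hK t f
  refine ⟨?_, max c 1, fun f _ => hN f⟩
  rintro f ⟨⟨f₀, h₀, f₁, h₁, hf⟩, hfin⟩
  exact ⟨⟨f₀, hs h₀, f₁, h₁, hf⟩,
    (hN f).trans_lt (ENNReal.mul_lt_top ENNReal.coe_lt_top hfin)⟩

end Space

/-! ### Lower bound for `K` on the couple `(L_{κ,∞}, L_∞)` -/

section KFunctional

variable {Ω 𝕜 : Type*} [RCLike 𝕜] [MeasurableSpace Ω] {μ : Measure Ω}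

theorem lorentzSpace_top_qnorm {k : ℝ} (hk : 0 < k) (f : Ω →ₘ[μ] 𝕜) :
    (lorentzSpace 𝕜 μ (ENNReal.ofReal k) ∞).qnorm f =
      essSup (fun t => ENNReal.ofReal (t ^ (1 / k)) * rearrangement f t)
        (volume.restrict (Ioi 0)) := by
  simp [lorentzSpace, lorentzKaramata, Space.ofNorm, weightedNorm_eq_haarNorm, haarNorm_top,
    hk.le]

theorem lebesgueSpace_embeds_lorentzSpace_top {k : ℝ} (hk : 0 < k) :
    (lebesgueSpace 𝕜 μ (ENNReal.ofReal k)).Embeds (lorentzSpace 𝕜 μ (ENNReal.ofReal k) ∞) := by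
  have h (f : Ω →ₘ[μ] 𝕜) : (lorentzSpace 𝕜 μ (ENNReal.ofReal k) ∞).qnorm f ≤
      (1 : ℝ≥0) * (lebesgueSpace 𝕜 μ (ENNReal.ofReal k)).qnorm f := by
    rw [lorentzSpace_top_qnorm hk, ENNReal.coe_one, one_mul]
    refine essSup_le_of_ae_le _ ?_
    filter_upwards [ae_restrict_mem measurableSet_Ioi] with t ht
    exact rpow_mul_rearrangement_le hk f ht
  exact ⟨fun f hf => (h f).trans_lt (ENNReal.mul_lt_top ENNReal.coe_lt_top hf), 1, fun f _ => h f⟩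

/-- The weak norm is an essential supremum, so it need not bound the value at the given point
directly. It does at some `s` in `((t/2)^k, t^k)`; monotonicity of `f*` moves the bound to `t^k`,
and `t/2 ≤ s^(1/k)` costs the factor `2`. -/
theorem mul_rearrangement_rpow_le_lorentzSpace_top_qnorm {k : ℝ} (hk : 0 < k) (f : Ω →ₘ[μ] 𝕜)
    {t : ℝ} (ht : 0 < t) :
    ENNReal.ofReal t * rearrangement f (t ^ k) ≤
      2 * (lorentzSpace 𝕜 μ (ENNReal.ofReal k) ∞).qnorm f := by
  rw [lorentzSpace_top_qnorm hk]
  have hlt : (t / 2) ^ k < t ^ k := Real.rpow_lt_rpow (by positivity) (by linarith) hk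
  obtain ⟨s, ⟨hs, hs'⟩, hle⟩ : ∃ s ∈ Ioo ((t / 2) ^ k) (t ^ k),
      ENNReal.ofReal (s ^ (1 / k)) * rearrangement f s ≤
      essSup (fun t => ENNReal.ofReal (t ^ (1 / k)) * rearrangement f t)
        (volume.restrict (Ioi 0)) := by
    by_contra! hcon
    have h := ae_restrict_iff' measurableSet_Ioi |>.1
      (ENNReal.ae_le_essSup (μ := volume.restrict (Ioi (0 : ℝ)))
        fun t => ENNReal.ofReal (t ^ (1 / k)) * rearrangement f t)
    have h0 : volume (Ioo ((t / 2) ^ k) (t ^ k)) = 0 := by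
      rw [measure_eq_zero_iff_ae_notMem]
      filter_upwards [h] with s hs hmem
      exact absurd (hs ((by positivity : (0 : ℝ) < (t / 2) ^ k).trans hmem.1))
        (not_le.2 (hcon s hmem))
    rw [Real.volume_Ioo, ENNReal.ofReal_eq_zero] at h0
    linarith
  have hs2 : t / 2 ≤ s ^ (1 / k) := by
    calc t / 2 = ((t / 2) ^ k) ^ (1 / k) := by
          rw [one_div, Real.rpow_rpow_inv (by positivity) hk.ne']
      _ ≤ _ := Real.rpow_le_rpow (by positivity) hs.le (by positivity)
  calc ENNReal.ofReal t * rearrangement f (t ^ k)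
      ≤ ENNReal.ofReal (2 * s ^ (1 / k)) * rearrangement f s := by
        gcongr
        · linarith
        · exact rearrangement_antitone f hs'.le
    _ = 2 * (ENNReal.ofReal (s ^ (1 / k)) * rearrangement f s) := by
        rw [ENNReal.ofReal_mul (by norm_num), mul_assoc, ENNReal.ofReal_ofNat]
    _ ≤ _ := by gcongr

theorem mul_rearrangement_rpow_le_K {k : ℝ} (hk : 0 < k) (f : Ω →ₘ[μ] 𝕜) {t : ℝ} (ht : 0 < t) :
    ENNReal.ofReal t * rearrangement f (t ^ k) ≤ (2 : ℝ≥0) *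
      Space.K (lorentzSpace 𝕜 μ (ENNReal.ofReal k) ∞) (lebesgueSpace 𝕜 μ ∞) t f := by
  refine Space.le_mul_K two_ne_zero ?_
  rintro f₀ - f₁ - rfl
  calc _ ≤ ENNReal.ofReal t * (rearrangement f₀ (t ^ k) + eLpNorm f₁ ∞ μ) := by
        gcongr
        exact rearrangement_add_le f₀ f₁ _
    _ = ENNReal.ofReal t * rearrangement f₀ (t ^ k) + ENNReal.ofReal t * eLpNorm f₁ ∞ μ :=
        mul_add _ _ _
    _ ≤ 2 * (lorentzSpace 𝕜 μ (ENNReal.ofReal k) ∞).qnorm f₀ +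
          2 * (ENNReal.ofReal t * eLpNorm f₁ ∞ μ) :=
        add_le_add (mul_rearrangement_rpow_le_lorentzSpace_top_qnorm hk f₀ ht)
          (le_mul_of_one_le_left' one_le_two)
    _ = _ := (mul_add _ _ _).symm

end KFunctional

/-! ### Upper bound for `K` on the couple `(L_κ, L_∞)` -/

section UpperEstimate

variable {Ω 𝕜 : Type*} [RCLike 𝕜] [MeasurableSpace Ω] {μ : Measure Ω}

theorem tendsto_half_pow_mul_rpow {k : ℝ} (hk : 0 < k) (t : ℝ) :
    Filter.Tendsto (fun j : ℕ => ENNReal.ofReal (((1 / 2 : ℝ) ^ j * t) ^ k)) Filter.atTop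
      (nhds 0) := by
  have h1 : Filter.Tendsto (fun j : ℕ => (1 / 2 : ℝ) ^ j * t) Filter.atTop (nhds 0) := by
    simpa using (tendsto_pow_atTop_nhds_zero_of_lt_one (by norm_num : (0 : ℝ) ≤ 1 / 2)
      (by norm_num)).mul_const t
  have h2 := ENNReal.tendsto_ofReal (h1.rpow_const (p := k) (Or.inr hk.le))
  simpa [Real.zero_rpow hk.ne'] using h2

/-- The part of `f` above its level `f*(t ^ k)`, cut dyadically at the levels
`f*((2 ^ (-j) * t) ^ k)`. -/
theorem lintegral_rpow_enorm_above_rearrangement_le {k : ℝ} (hk : 0 < k) (f : Ω →ₘ[μ] 𝕜)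
    {t : ℝ} (ht : 0 < t) :
    ∫⁻ x, {x | rearrangement f (t ^ k) < ‖f x‖ₑ}.indicator (fun x => ‖f x‖ₑ ^ k) x ∂μ ≤
      ∑' j : ℕ, (ENNReal.ofReal ((1 / 2 : ℝ) ^ j * t) *
        rearrangement f (((1 / 2 : ℝ) ^ (j + 1) * t) ^ k)) ^ k := by
  set l : ℕ → ℝ≥0∞ := fun j => rearrangement f (((1 / 2 : ℝ) ^ j * t) ^ k)
  set A : ℕ → Set Ω := fun j => {x | l j < ‖f x‖ₑ}
  have hl0 : rearrangement f (t ^ k) = l 0 := by simp [l]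
  have hA (j : ℕ) : MeasurableSet (A j) :=
    measurableSet_lt measurable_const f.measurable.enorm
  have hμA (j : ℕ) : μ (A j) ≤ ENNReal.ofReal (((1 / 2 : ℝ) ^ j * t) ^ k) :=
    measure_rearrangement_lt_le f _
  -- Almost no point exceeds every level, so almost every point of `A 0` leaves the sequence `A j`
  -- at a finite stage.
  have hnull : μ (⋂ j, A j) = 0 := le_antisymm
    (ge_of_tendsto' (tendsto_half_pow_mul_rpow hk t)
      fun j => (measure_mono (iInter_subset A j)).trans (hμA j)) zero_le
  rw [hl0]
  calc ∫⁻ x, (A 0).indicator (fun x => ‖f x‖ₑ ^ k) x ∂μ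
      ≤ ∫⁻ x, ∑' j : ℕ, (A j).indicator (fun _ => l (j + 1) ^ k) x ∂μ := by
        refine lintegral_mono_ae ?_
        filter_upwards [measure_eq_zero_iff_ae_notMem.1 hnull] with x hx
        by_cases hx0 : x ∈ A 0
        · have hex : ∃ j, x ∉ A (j + 1) := by
            by_contra! hcon
            exact hx (mem_iInter.2 fun j => by cases j <;> simp_all)
          classical
          have hmem : x ∈ A (Nat.find hex) := by
            rcases h : Nat.find hex with _ | j
            · exact hx0
            · have := Nat.find_min hex (m := j) (by omega)
              exact not_not.1 this
          -- For the least `j` with `x ∉ A (j + 1)`, one has `x ∈ A j` and `|f x| ≤ l (j + 1)`: this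
          -- single term suffices.
          refine le_trans ?_ (ENNReal.le_tsum (Nat.find hex))
          rw [indicator_of_mem hx0, indicator_of_mem hmem]
          exact ENNReal.rpow_le_rpow (not_lt.1 (Nat.find_spec hex)) hk.le
        · simp [hx0]
    _ = ∑' j : ℕ, l (j + 1) ^ k * μ (A j) := by
        rw [lintegral_tsum fun j => (measurable_const.indicator (hA j)).aemeasurable]
        exact tsum_congr fun j => lintegral_indicator_const (hA j) _
    _ ≤ _ := by
        refine ENNReal.tsum_le_tsum fun j => ?_
        rw [ENNReal.mul_rpow_of_nonneg _ _ hk.le,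
          ENNReal.ofReal_rpow_of_nonneg (by positivity) hk.le, mul_comm]
        gcongr
        exact hμA j

/-- Splits `f` into its restrictions to `{|f| > f*(t^k)}` and to the complement. Finiteness of `M`
and of the level places the pieces in `L_k` and `L_∞`. -/
theorem K_lebesgueSpace_le_of_rearrangement_ne_top {k : ℝ} (hk : 0 < k) (f : Ω →ₘ[μ] 𝕜)
    {t : ℝ} {M : ℝ≥0∞} (hM : M ≠ ∞) (hl : rearrangement f (t ^ k) ≠ ∞)
    (h : ∫⁻ x, {x | rearrangement f (t ^ k) < ‖f x‖ₑ}.indicator (fun x => ‖f x‖ₑ ^ k) x ∂μ ≤ M) :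
    Space.K (lebesgueSpace 𝕜 μ (ENNReal.ofReal k)) (lebesgueSpace 𝕜 μ ∞) t f ≤
      M ^ (1 / k) + ENNReal.ofReal t * rearrangement f (t ^ k) := by
  set l := rearrangement f (t ^ k)
  set A : Set Ω := {x | l < ‖f x‖ₑ}
  have hA : MeasurableSet A := measurableSet_lt measurable_const f.measurable.enorm
  have m₀ : AEStronglyMeasurable (A.indicator f) μ := f.aestronglyMeasurable.indicator hA
  have m₁ : AEStronglyMeasurable (Aᶜ.indicator f) μ := f.aestronglyMeasurable.indicator hA.compl
  have hsum : f = AEEqFun.mk _ m₀ + AEEqFun.mk _ m₁ := by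
    refine AEEqFun.ext ?_
    filter_upwards [AEEqFun.coeFn_add (AEEqFun.mk _ m₀) (AEEqFun.mk _ m₁),
      AEEqFun.coeFn_mk _ m₀, AEEqFun.coeFn_mk _ m₁] with x h1 h2 h3
    rw [h1, Pi.add_apply, h2, h3]
    exact (congrFun (indicator_self_add_compl A f) x).symm
  have h₀ : eLpNorm (AEEqFun.mk _ m₀) (ENNReal.ofReal k) μ ≤ M ^ (1 / k) := by
    rw [eLpNorm_congr_ae (AEEqFun.coeFn_mk _ m₀),
      eLpNorm_eq_lintegral_rpow_enorm_toReal (by simpa using hk) ENNReal.ofReal_ne_top,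
      ENNReal.toReal_ofReal hk.le]
    refine ENNReal.rpow_le_rpow (le_trans (le_of_eq ?_) h) (by positivity)
    refine lintegral_congr fun x => ?_
    by_cases hx : x ∈ A <;> simp [hx, hk]
  have h₁ : eLpNorm (AEEqFun.mk _ m₁) ∞ μ ≤ l := by
    rw [eLpNorm_congr_ae (AEEqFun.coeFn_mk _ m₁), eLpNorm_exponent_top]
    refine essSup_le_of_ae_le _ (Filter.Eventually.of_forall fun x => ?_)
    by_cases hx : x ∈ A
    · simp [hx]
    · simpa [hx] using not_lt.1 hx
  conv_lhs => rw [hsum]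
  refine (Space.K_le (A₀ := lebesgueSpace 𝕜 μ (ENNReal.ofReal k)) (A₁ := lebesgueSpace 𝕜 μ ∞)
    (h₀.trans_lt (ENNReal.rpow_lt_top_of_nonneg (by positivity) hM))
    (h₁.trans_lt hl.lt_top) t).trans ?_
  exact add_le_add h₀ (mul_le_mul_right h₁ _)

theorem K_lebesgueSpace_le_iSup {k : ℝ} (hk : 0 < k) {γ : ℝ} (hγ : 1 / 2 < γ) :
    ∃ C : ℝ≥0, ∀ (f : Ω →ₘ[μ] 𝕜) (t : ℝ), 0 < t →
      Space.K (lebesgueSpace 𝕜 μ (ENNReal.ofReal k)) (lebesgueSpace 𝕜 μ ∞) t f ≤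
        C * ⨆ j : ℕ, ENNReal.ofReal (γ ^ j * t) *
          rearrangement f (((1 / 2 : ℝ) ^ (j + 1) * t) ^ k) := by
  have hγ0 : 0 < γ := by linarith
  -- Writing `2^(-j) = η^j γ^j` leaves the summable factor `η^(jk)` once `γ^j t l_(j+1)` is bounded
  -- by the supremum; this is where `γ > 1/2` enters.
  set η : ℝ := 1 / 2 / γ
  have hη0 : 0 < η := by positivity
  have hη1 : η < 1 := (div_lt_one hγ0).2 hγ
  set r : ℝ≥0∞ := ENNReal.ofReal η ^ k
  have hr : r < 1 := ENNReal.rpow_lt_one (by simpa using hη1) hk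
  have hsum : (∑' j : ℕ, r ^ j) ≠ ∞ := by
    rw [ENNReal.tsum_geometric]
    simpa [tsub_eq_zero_iff_le] using hr
  have hD : (∑' j : ℕ, r ^ j) ^ (1 / k) ≠ ∞ :=
    ENNReal.rpow_ne_top_of_nonneg (by positivity) hsum
  -- The geometric series bounds the `L_k` piece; the extra `1` pays for the `L_∞` piece, which the
  -- term `j = 0` dominates.
  refine ⟨((∑' j : ℕ, r ^ j) ^ (1 / k)).toNNReal + 1, fun f t ht => ?_⟩
  set S : ℝ≥0∞ := ⨆ j : ℕ, ENNReal.ofReal (γ ^ j * t) *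
          rearrangement f (((1 / 2 : ℝ) ^ (j + 1) * t) ^ k)
  rcases eq_or_ne S ∞ with hS | hS
  · rw [hS, ENNReal.mul_top (by simp)]
    exact le_top
  have ht0 : ENNReal.ofReal t ≠ 0 := by simpa using ht
  have hbase : ENNReal.ofReal t * rearrangement f (t ^ k) ≤ S := by
    refine le_trans ?_ (le_iSup _ 0)
    simp only [pow_zero, one_mul, zero_add, pow_one]
    gcongr
    exact rearrangement_antitone f (Real.rpow_le_rpow (by positivity) (by linarith) hk.le)
  have hl : rearrangement f (t ^ k) ≠ ∞ := fun hcon => by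
    rw [hcon, ENNReal.mul_top ht0, top_le_iff] at hbase
    exact hS hbase
  have hint : ∑' j : ℕ, (ENNReal.ofReal ((1 / 2 : ℝ) ^ j * t) *
        rearrangement f (((1 / 2 : ℝ) ^ (j + 1) * t) ^ k)) ^ k ≤ (∑' j : ℕ, r ^ j) * S ^ k := by
    rw [← ENNReal.tsum_mul_right]
    refine ENNReal.tsum_le_tsum fun j => ?_
    have hj : r ^ j = (ENNReal.ofReal (η ^ j)) ^ k := by
      rw [ENNReal.ofReal_pow hη0.le, ← ENNReal.rpow_natCast, ← ENNReal.rpow_natCast,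
        ← ENNReal.rpow_mul, ← ENNReal.rpow_mul, mul_comm k]
    have he : (1 / 2 : ℝ) ^ j * t = η ^ j * (γ ^ j * t) := by
      rw [← mul_assoc, ← mul_pow, div_mul_cancel₀ _ hγ0.ne']
    rw [hj, ← ENNReal.mul_rpow_of_nonneg _ _ hk.le]
    refine ENNReal.rpow_le_rpow ?_ hk.le
    rw [he, ENNReal.ofReal_mul (by positivity), mul_assoc]
    gcongr
    exact le_iSup (fun j : ℕ => ENNReal.ofReal (γ ^ j * t) *
          rearrangement f (((1 / 2 : ℝ) ^ (j + 1) * t) ^ k)) j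
  refine (K_lebesgueSpace_le_of_rearrangement_ne_top hk f
    (ENNReal.mul_ne_top hsum (ENNReal.rpow_ne_top_of_nonneg hk.le hS)) hl
    ((lintegral_rpow_enorm_above_rearrangement_le hk f ht).trans hint)).trans ?_
  rw [ENNReal.mul_rpow_of_nonneg _ _ (by positivity), ← ENNReal.rpow_mul,
    mul_one_div_cancel hk.ne', ENNReal.rpow_one, ENNReal.coe_add, ENNReal.coe_toNNReal hD, add_mul,
    ENNReal.coe_one, one_mul]
  gcongr

end UpperEstimate

/-! ### The embeddings between interpolation and Lorentz–Karamata spaces -/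

section Interpolation

theorem exists_lt_top_of_haarNorm_lt_top {q : ℝ≥0∞} (hq : q ≠ 0) {G : ℝ → ℝ≥0∞}
    (h : haarNorm q G < ∞) : ∃ t, 0 < t ∧ G t < ∞ := by
  by_contra! hcon
  have hG : ∀ t, 0 < t → G t = ∞ := fun t ht => top_le_iff.1 (hcon t ht)
  refine h.ne ?_
  rcases eq_or_ne q ∞ with rfl | hq'
  · have hae : G =ᵐ[volume.restrict (Ioi 0)] fun _ => ∞ := by
      filter_upwards [ae_restrict_mem measurableSet_Ioi] with t ht using hG t ht
    rw [haarNorm_top, essSup_congr_ae hae, essSup_const _ (by simp [Measure.restrict_eq_zero])]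
  · have hpos := ENNReal.toReal_pos hq hq'
    rw [haarNorm_of_ne_top hq hq', setLIntegral_congr_fun (g := fun _ => ∞) measurableSet_Ioi]
    · simp [hpos]
    · intro t ht
      have ht : 0 < t := ht
      simp [hG t ht, hpos, ENNReal.mul_top, ht]

theorem haarNorm_comp_rpow_le_weightedNorm {r k : ℝ} (hk : 0 < k) {q : ℝ≥0∞} (hq : q ≠ 0)
    (b : ℝ → ℝ) :
    ∃ C : ℝ≥0, ∀ φ : ℝ → ℝ≥0∞,
      haarNorm q (fun t => ENNReal.ofReal (t ^ r * b t) * φ (t ^ k)) ≤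
        C * weightedNorm (r / k) q (fun t => b (t ^ (1 / k))) φ := by
  refine ⟨_, fun φ => le_trans ?_ ((haarNorm_comp_mul_rpow_le one_pos hk hq
    fun t => ENNReal.ofReal (t ^ (r / k) * b (t ^ (1 / k))) * φ t).trans_eq
      (by rw [weightedNorm_eq_haarNorm]))⟩
  refine (haarNorm_congr fun t ht => ?_).le
  simp only [one_mul]
  rw [← Real.rpow_mul ht.le, ← Real.rpow_mul ht.le, mul_div_cancel₀ _ hk.ne',
    mul_one_div_cancel hk.ne', Real.rpow_one]

theorem weightedNorm_le_haarNorm_comp_rpow {r k : ℝ} (hk : 0 < k) {q : ℝ≥0∞} (hq : q ≠ 0)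
    (b : ℝ → ℝ) :
    ∃ C : ℝ≥0, ∀ φ : ℝ → ℝ≥0∞,
      weightedNorm (r / k) q (fun t => b (t ^ (1 / k))) φ ≤
        C * haarNorm q (fun t => ENNReal.ofReal (t ^ r * b t) * φ (t ^ k)) := by
  refine ⟨_, fun φ => le_trans ?_ (haarNorm_comp_mul_rpow_le one_pos (inv_pos.2 hk) hq
    fun t => ENNReal.ofReal (t ^ r * b t) * φ (t ^ k))⟩
  rw [weightedNorm_eq_haarNorm]
  refine (haarNorm_congr fun t ht => ?_).le
  simp only [one_mul]
  rw [← Real.rpow_mul ht.le, ← Real.rpow_mul ht.le, inv_mul_cancel₀ hk.ne', Real.rpow_one,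
    one_div, inv_mul_eq_div]

variable {Ω 𝕜 : Type*} [RCLike 𝕜] [MeasurableSpace Ω] {μ : Measure Ω}

theorem interp_lorentzSpace_top_embeds {k : ℝ} (hk : 0 < k) (θ : ℝ) {p : ℝ≥0∞}
    (hp : (p⁻¹).toReal = (1 - θ) / k) {q : ℝ≥0∞} (hq : q ≠ 0) (b : ℝ → ℝ) :
    (Space.interp (lorentzSpace 𝕜 μ (ENNReal.ofReal k) ∞) (lebesgueSpace 𝕜 μ ∞) θ q b).Embeds
      (lorentzKaramata 𝕜 μ p q fun t => b (t ^ (1 / k))) := by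
  obtain ⟨C, hC⟩ := weightedNorm_le_haarNorm_comp_rpow (r := 1 - θ) hk hq b
  have h (f : Ω →ₘ[μ] 𝕜) : weightedNorm (p⁻¹).toReal q (fun t => b (t ^ (1 / k)))
      (rearrangement f) ≤ (C * 2 : ℝ≥0) * Space.interpNorm
        (lorentzSpace 𝕜 μ (ENNReal.ofReal k) ∞) (lebesgueSpace 𝕜 μ ∞) θ q b f := by
    rw [hp, Space.interpNorm, weightedNorm_eq_haarNorm (-θ), ENNReal.coe_mul, mul_assoc]
    refine (hC _).trans (mul_le_mul_right (haarNorm_mono fun t ht => ?_) _)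
    rw [mul_left_comm]
    calc _ = ENNReal.ofReal (t ^ (-θ) * b t) * (ENNReal.ofReal t * rearrangement f (t ^ k)) := by
          rw [← mul_assoc, ← ENNReal.ofReal_mul' ht.le, sub_eq_neg_add, Real.rpow_add ht,
            Real.rpow_one]
          ring_nf
      _ ≤ _ := mul_le_mul_right (mul_rearrangement_rpow_le_K hk f ht) _
  exact ⟨fun f hf => (h f).trans_lt (ENNReal.mul_lt_top ENNReal.coe_lt_top hf.2),
    _, fun f _ => h f⟩

/-- With `l = 2^(j+1)` and `t = l s`, the power `t^(1-θ)` contributes `l^(1-θ)` and slow variation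
at most `l^(θ/4)`. Together with `2^(θ/4-1)` the exponent per step is `-θ/2`, hence decay in `j`. -/
theorem SlowlyVarying.rpow_mul_le {b : ℝ → ℝ} (hb : SlowlyVarying b) {θ : ℝ} (hθ : 0 < θ) :
    ∃ A : ℝ, 0 < A ∧ ∀ (j : ℕ) (t : ℝ), 0 < t →
      t ^ (-θ) * b t * (((2 : ℝ) ^ (θ / 4 - 1)) ^ j * t) ≤ A * (((2 : ℝ) ^ (-(θ / 2))) ^ j *
        (((1 / 2 : ℝ) ^ (j + 1) * t) ^ (1 - θ) * b ((1 / 2 : ℝ) ^ (j + 1) * t))) := by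
  obtain ⟨C, hC, h⟩ := hb.mul_le (ε := θ / 4) (by positivity)
  refine ⟨C * (2 : ℝ) ^ (1 - θ + θ / 4), by positivity, fun j t ht => ?_⟩
  set s : ℝ := (1 / 2 : ℝ) ^ (j + 1) * t
  set l : ℝ := (2 : ℝ) ^ (j + 1)
  have hs : 0 < s := by positivity
  have hl : 0 < l := by positivity
  have hts : t = l * s := by
    rw [← mul_assoc, ← mul_pow]; norm_num
  have hbt : b t ≤ C * l ^ (θ / 4) * b s := by
    rw [hts]; exact h l s (one_le_pow₀ one_le_two) hs
  have hlp : l ^ (1 - θ) * l ^ (θ / 4) = ((2 : ℝ) ^ (1 - θ + θ / 4)) ^ (j + 1) := by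
    rw [← Real.rpow_add hl, Real.rpow_pow_comm zero_le_two]
  have hρ : (2 : ℝ) ^ (θ / 4 - 1) * (2 : ℝ) ^ (1 - θ + θ / 4) = (2 : ℝ) ^ (-(θ / 2)) := by
    rw [← Real.rpow_add two_pos]; ring_nf
  have ht1 : t ^ (-θ) * t = l ^ (1 - θ) * s ^ (1 - θ) := by
    rw [← Real.mul_rpow hl.le hs.le, ← hts, sub_eq_neg_add, Real.rpow_add ht, Real.rpow_one]
  calc _ = ((2 : ℝ) ^ (θ / 4 - 1)) ^ j * (t ^ (-θ) * t) * b t := by ring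
    _ ≤ ((2 : ℝ) ^ (θ / 4 - 1)) ^ j * (t ^ (-θ) * t) * (C * l ^ (θ / 4) * b s) := by gcongr
    _ = C * ((2 : ℝ) ^ (θ / 4 - 1)) ^ j * (l ^ (1 - θ) * l ^ (θ / 4)) * (s ^ (1 - θ) * b s) := by
        rw [ht1]; ring
    _ = C * 2 ^ (1 - θ + θ / 4) * (((2 : ℝ) ^ (θ / 4 - 1)) * 2 ^ (1 - θ + θ / 4)) ^ j *
          (s ^ (1 - θ) * b s) := by rw [hlp]; ring
    _ = _ := by rw [hρ]; ring

theorem lorentzKaramata_embeds_interp {k : ℝ} (hk : 0 < k) {θ : ℝ} (hθ : 0 < θ) {p : ℝ≥0∞}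
    (hp : (p⁻¹).toReal = (1 - θ) / k) {q : ℝ≥0∞} (hq : q ≠ 0) {b : ℝ → ℝ}
    (hb : SlowlyVarying b) :
    (lorentzKaramata 𝕜 μ p q fun t => b (t ^ (1 / k))).Embeds
      (Space.interp (lebesgueSpace 𝕜 μ (ENNReal.ofReal k)) (lebesgueSpace 𝕜 μ ∞) θ q b) := by
  have hγ : 1 / 2 < (2 : ℝ) ^ (θ / 4 - 1) := by
    rw [one_div, ← Real.rpow_neg_one]
    exact Real.rpow_lt_rpow_of_exponent_lt one_lt_two (by linarith)
  have hρ : (2 : ℝ) ^ (-(θ / 2)) < 1 :=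
    Real.rpow_lt_one_of_one_lt_of_neg one_lt_two (by linarith)
  obtain ⟨C₁, h₁⟩ := K_lebesgueSpace_le_iSup (μ := μ) (𝕜 := 𝕜) hk hγ
  obtain ⟨A, hA₀, hA⟩ := hb.rpow_mul_le hθ
  obtain ⟨C₂, h₂⟩ := haarNorm_iSup_dilation_le hq hρ
    (c := fun j => (1 / 2 : ℝ) ^ (j + 1)) (fun j => by positivity)
  obtain ⟨C₃, h₃⟩ := haarNorm_comp_rpow_le_weightedNorm (r := 1 - θ) hk hq b
  have h (f : Ω →ₘ[μ] 𝕜) : Space.interpNorm (lebesgueSpace 𝕜 μ (ENNReal.ofReal k))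
      (lebesgueSpace 𝕜 μ ∞) θ q b f ≤ (C₁ * A.toNNReal * (C₂ * C₃) : ℝ≥0) *
        weightedNorm (p⁻¹).toReal q (fun t => b (t ^ (1 / k))) (rearrangement f) := by
    set H : ℝ → ℝ≥0∞ := fun t => ENNReal.ofReal (t ^ (1 - θ) * b t) * rearrangement f (t ^ k)
    -- Needed to exchange sum and integral over the dilates. The `K`-functional is only bounded
    -- pointwise, so its measurability plays no role.
    have hH : AEMeasurable H (volume.restrict (Ioi 0)) := by
      have hbm := hb.aemeasurable
      have hr : Measurable fun t : ℝ => rearrangement f (t ^ k) :=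
        (rearrangement_antitone f).measurable.comp (by fun_prop)
      exact ((AEMeasurable.mul (by fun_prop) hbm).ennreal_ofReal).mul hr.aemeasurable
    have hpt : ∀ t, 0 < t → ENNReal.ofReal (t ^ (-θ) * b t) *
        Space.K (lebesgueSpace 𝕜 μ (ENNReal.ofReal k)) (lebesgueSpace 𝕜 μ ∞) t f ≤
        (C₁ * A.toNNReal : ℝ≥0) * ⨆ j : ℕ, ENNReal.ofReal ((2 : ℝ) ^ (-(θ / 2))) ^ j *
          H ((1 / 2 : ℝ) ^ (j + 1) * t) := by
      intro t ht
      refine (mul_le_mul_right (h₁ f t ht) _).trans ?_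
      rw [mul_left_comm, ENNReal.coe_mul, mul_assoc, ENNReal.mul_iSup,
        ENNReal.mul_iSup (a := (A.toNNReal : ℝ≥0∞))]
      refine mul_le_mul_right (iSup_mono fun j => ?_) _
      have hj := mul_le_mul_left (ENNReal.ofReal_le_ofReal (hA j t ht))
        (rearrangement f (((1 / 2 : ℝ) ^ (j + 1) * t) ^ k))
      rw [ENNReal.ofReal_mul (p := t ^ (-θ) * b t) (mul_pos (by positivity) (hb.pos t ht)).le,
        ENNReal.ofReal_mul hA₀.le,
        ENNReal.ofReal_mul (p := ((2 : ℝ) ^ (-(θ / 2))) ^ j) (by positivity),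
        ENNReal.ofReal_pow (by positivity)] at hj
      simpa only [H, ENNReal.ofReal, mul_assoc] using hj
    rw [hp, Space.interpNorm, weightedNorm_eq_haarNorm (-θ), ENNReal.coe_mul, mul_assoc]
    refine (haarNorm_mono hpt).trans (mul_le_mul_right ?_ _)
    rw [ENNReal.coe_mul, mul_assoc]
    exact (h₂ H hH).trans (mul_le_mul_right (h₃ _) _)
  refine ⟨fun f hf => ?_, _, fun f _ => h f⟩
  have hfin := (h f).trans_lt (ENNReal.mul_lt_top ENNReal.coe_lt_top hf)
  refine ⟨?_, hfin⟩
  -- A finite norm forces `K(t, f) < ∞` for some `t`, which yields a decomposition of `f` and hence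
  -- membership in the sum space.
  rw [Space.interpNorm, weightedNorm_eq_haarNorm] at hfin
  obtain ⟨t, ht, htop⟩ := exists_lt_top_of_haarNorm_lt_top hq hfin
  refine Space.exists_decomposition_of_K_lt_top (t := t) (lt_top_iff_ne_top.2 fun hK => ?_)
  have hb0 := hb.pos t ht
  have h0 : ENNReal.ofReal (t ^ (-θ) * b t) ≠ 0 := by
    simpa using (by positivity : 0 < t ^ (-θ) * b t)
  rw [hK, ENNReal.mul_top h0] at htop
  exact lt_irrefl _ htop

end Interpolation

end LorentzKaramata

end

theorem theorem5p1 {Ω 𝕜 : Type*} [RCLike 𝕜] [MeasurableSpace Ω] (μ : Measure Ω) [SigmaFinite μ]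
    (hμ : LorentzKaramata.NonAtomic μ)
    (θ : ℝ) (hθ₀ : 0 < θ) (hθ₁ : θ ≤ 1) (κ : ℝ) (hκ : 0 < κ)
    (p : ℝ≥0∞) (hp : p = ENNReal.ofReal κ / ENNReal.ofReal (1 - θ))
    (q : ℝ≥0∞) (hq : 0 < q) (b : ℝ → ℝ) (hb : LorentzKaramata.SlowlyVarying b) :
    (LorentzKaramata.Space.interp
        (LorentzKaramata.lebesgueSpace 𝕜 μ (ENNReal.ofReal κ))
        (LorentzKaramata.lebesgueSpace 𝕜 μ ∞) θ q b).Same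
      (LorentzKaramata.lorentzKaramata 𝕜 μ p q fun t => b (t ^ (1 / κ))) ∧
    (LorentzKaramata.Space.interp
        (LorentzKaramata.lorentzSpace 𝕜 μ (ENNReal.ofReal κ) ∞)
        (LorentzKaramata.lebesgueSpace 𝕜 μ ∞) θ q b).Same
      (LorentzKaramata.lorentzKaramata 𝕜 μ p q fun t => b (t ^ (1 / κ))) := by
  -- For `θ = 1` division by zero gives `p = ∞`, and both sides vanish.
  have hp' : (p⁻¹).toReal = (1 - θ) / κ := by
    rw [hp, ENNReal.inv_div (Or.inl ENNReal.ofReal_ne_top) (Or.inr (by simpa using hκ)),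
      ENNReal.toReal_div, ENNReal.toReal_ofReal (by linarith), ENNReal.toReal_ofReal hκ.le]
  have h₁ := (LorentzKaramata.lebesgueSpace_embeds_lorentzSpace_top (𝕜 := 𝕜) (μ := μ)
    hκ).interp_left (LorentzKaramata.lebesgueSpace 𝕜 μ ∞) θ q b
  have h₂ := LorentzKaramata.interp_lorentzSpace_top_embeds (𝕜 := 𝕜) (μ := μ) hκ θ hp' hq.ne' b
  have h₃ := LorentzKaramata.lorentzKaramata_embeds_interp (𝕜 := 𝕜) (μ := μ) hκ hθ₀ hp' hq.ne' hb
  exact ⟨⟨h₁.trans h₂, h₃⟩, h₂, h₃.trans h₁⟩
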